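/- A metric graph $G$ consists of finitely many vertices and finitely many edges (loops and multiple edges are allowed), each edge $e$ being identified with an interval $[0,|e|]$ of finite length $|e|>0$ whose endpoints are glued to vertices; let $E$ be its number of edges. It is equilateral if all edges have the same length. Let $-\Delta$ be the operator acting as $-u''$ on each edge, on the real functions $u$ on $G$ that lie in $H^2$ on each edge, are continuous at the vertices, and satisfy the Kirchhoff condition that at every vertex the derivatives along all incident edge ends, taken in the direction pointing into the edge, sum to zero (a loop contributes both its ends). If $G$ is connected, $0$ is a simple eigenvalue of $-\Delta$; let $\lambda_1(G)>0$ be the smallest positive eigenvalue. Let $G$ be a connected equilateral metric graph with $E\ge 3$ edges. Then there is an eigenfunction of $-\Delta$ for the eigenvalue $\lambda_1(G)$ that vanishes at all vertices of $G$ if and only if $G$ is an (equilateral) pumpkin graph, i.e. $G$ has exactly two vertices and every edge joins these two vertices, or an (equilateral) flower graph, i.e. $G$ has exactly one vertex and every edge is a loop at it. -/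

import Mathlib

/-- A metric graph with vertex set `V` and edge set `E`: multiple edges and loops are allowed, and
each edge `e` is identified with the interval `[0, len e]`, the point `0` being glued to the vertex
`init e` and the point `len e` to the vertex `term e`. (The orientation only fixes the
parametrisation of the edge.) -/
structure MetricGraph (V E : Type*) where
  init : E → V
  term : E → V
  len : E → ℝ
  len_pos : ∀ e, 0 < len e

namespace MetricGraph

variable {V E : Type*}

/-- `G.Joins e v w`: the endpoints of the edge `e` are `v` and `w`, in either order. -/
def Joins (G : MetricGraph V E) (e : E) (v w : V) : Prop :=
  (G.init e = v ∧ G.term e = w) ∨ (G.init e = w ∧ G.term e = v)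

/-- The graph is non-empty and any two vertices are linked by a path of edges. -/
def IsConnected (G : MetricGraph V E) : Prop :=
  Nonempty V ∧ ∀ v w : V, Relation.ReflTransGen (fun a b => ∃ e, G.Joins e a b) v w

/-- All edges have the same length. -/
def IsEquilateral (G : MetricGraph V E) : Prop :=
  ∀ e e' : E, G.len e = G.len e'

/-- Exactly two vertices, and every edge has both of them as endpoints. -/
def IsPumpkin (G : MetricGraph V E) : Prop :=
  ∃ v w : V, v ≠ w ∧ (∀ x : V, x = v ∨ x = w) ∧ ∀ e : E, G.Joins e v w

/-- Exactly one vertex, and every edge is a loop attached to it. -/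
def IsFlower (G : MetricGraph V E) : Prop :=
  ∃ v : V, (∀ x : V, x = v) ∧ ∀ e : E, G.Joins e v v

/-- A real function on the metric graph which is compatible with the gluing at the vertices.
Only the values of `edge e` on `[0, len e]` are meaningful. -/
structure Fun (G : MetricGraph V E) where
  vertex : V → ℝ
  edge : E → ℝ → ℝ
  edge_zero : ∀ e, edge e 0 = vertex (G.init e)
  edge_len : ∀ e, edge e (G.len e) = vertex (G.term e)

/-- `u` belongs to the Sobolev space `H²(0, ℓ)`, with first derivative `u'` (its continuous
representative on `[0, ℓ]`) and weak second derivative `u'' ∈ L²(0, ℓ)`. -/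
structure IsH2 (ℓ : ℝ) (u u' u'' : ℝ → ℝ) : Prop where
  memLp : MeasureTheory.MemLp u'' 2 (MeasureTheory.volume.restrict (Set.Ioo 0 ℓ))
  deriv_eq : ∀ x ∈ Set.Icc 0 ℓ, u' x = u' 0 + ∫ t in (0 : ℝ)..x, u'' t
  eq : ∀ x ∈ Set.Icc 0 ℓ, u x = u 0 + ∫ t in (0 : ℝ)..x, u' t

open Classical in
/-- The sum at the vertex `v` of the derivatives, in the directions pointing from `v` into the
edges, of a function with edgewise derivative `u'`. A loop at `v` contributes two terms. -/
noncomputable def normalDerivSum [Fintype E] (G : MetricGraph V E) (u' : E → ℝ → ℝ) (v : V) : ℝ :=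
  ∑ e, ((if G.init e = v then u' e 0 else 0) - (if G.term e = v then u' e (G.len e) else 0))

/-- `f` belongs to the domain of the Laplacian `Δ` with natural (continuity and Kirchhoff) vertex
conditions, and `Δ f = g` on the edges. Continuity at the vertices is built into `G.Fun`. -/
def HasLaplacian [Fintype E] (G : MetricGraph V E) (f : G.Fun) (g : E → ℝ → ℝ) : Prop :=
  ∃ u' : E → ℝ → ℝ, (∀ e, IsH2 (G.len e) (f.edge e) (u' e) (g e)) ∧
    ∀ v, G.normalDerivSum u' v = 0

/-- `f` is a non-zero function in the domain of `Δ` with `-Δ f = μ f` in `L²`. -/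
def IsEigenfunction [Fintype E] (G : MetricGraph V E) (μ : ℝ) (f : G.Fun) : Prop :=
  (∃ e, ∃ x ∈ Set.Icc 0 (G.len e), f.edge e x ≠ 0) ∧
    ∃ g : E → ℝ → ℝ, G.HasLaplacian f g ∧
      ∀ e, ∀ᵐ x ∂(MeasureTheory.volume.restrict (Set.Ioo 0 (G.len e))), -g e x = μ * f.edge e x

/-- `μ` is an eigenvalue of `-Δ`. -/
def IsEigenvalue [Fintype E] (G : MetricGraph V E) (μ : ℝ) : Prop :=
  ∃ f : G.Fun, G.IsEigenfunction μ f

/-- The spectral gap `λ₁` of a connected graph: the lowest positive eigenvalue of `-Δ`. -/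
noncomputable def lambda1 [Fintype E] (G : MetricGraph V E) : ℝ :=
  sInf {μ : ℝ | 0 < μ ∧ G.IsEigenvalue μ}

end MetricGraph

/-! Let `L` be the common edge length. For `0 < kL < π` a solution of `-u'' = k² u` on an edge is
determined by its endpoint values, so the Kirchhoff conditions become `A x = cos(kL) D x` for the
vertex values `x`, with `A` the adjacency and `D` the degree matrix. Thus the eigenvalues in `(0,
(π/L)²)` correspond to the eigenvalues in `(-1, 1)` of the transition matrix `D⁻¹A`
(`IsEigenfunction.incSum_eq_zero`, `isEigenvalue_of_incSum_eq_zero`).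

An eigenfunction for `λ₁` vanishing at all vertices forces `λ₁ ≥ (π/L)²`. The spectrum of `D⁻¹A`
then lies in `{-1, 1}`, so `N = D^(-1/2) A D^(-1/2)` satisfies `N² = 1`. As `N` has nonnegative
entries, no walk of length two joins distinct vertices, which leaves only pumpkins and flowers.

Conversely, for these two graphs the vertex equations have no nonzero solution when `|c| < 1`, and
sines whose amplitudes sum to zero attain the eigenvalue `(π/L)²`. -/

namespace MetricGraph

open Real

/-! ### Regularity and explicit solutions on one edge -/

/-- A twice continuously differentiable function belongs to `H²`. -/
theorem isH2_of_hasDerivAt {ℓ : ℝ} {u u' u'' : ℝ → ℝ} (h1 : ∀ x, HasDerivAt u (u' x) x)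
    (h2 : ∀ x, HasDerivAt u' (u'' x) x) (hc : Continuous u'') : IsH2 ℓ u u' u'' where
  memLp := by
    obtain ⟨C, hC⟩ := isCompact_Icc.exists_bound_of_continuousOn (s := Set.Icc 0 ℓ) hc.continuousOn
    refine MeasureTheory.MemLp.of_bound hc.aestronglyMeasurable C ?_
    filter_upwards [MeasureTheory.ae_restrict_mem measurableSet_Ioo] with x hx
    exact hC x (Set.Ioo_subset_Icc_self hx)
  deriv_eq := fun x _ => by
    rw [intervalIntegral.integral_eq_sub_of_hasDerivAt (fun y _ => h2 y)
      (hc.intervalIntegrable _ _)]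
    ring
  eq := fun x _ => by
    have hc' : Continuous u' := continuous_iff_continuousAt.2 fun y => (h2 y).continuousAt
    rw [intervalIntegral.integral_eq_sub_of_hasDerivAt (fun y _ => h1 y)
      (hc'.intervalIntegrable _ _)]
    ring

theorem continuousOn_of_eq_integral {ℓ : ℝ} {u g : ℝ → ℝ} (hℓ : 0 ≤ ℓ)
    (hg : MeasureTheory.IntegrableOn g (Set.Icc 0 ℓ))
    (h : ∀ x ∈ Set.Icc 0 ℓ, u x = u 0 + ∫ t in (0 : ℝ)..x, g t) :
    ContinuousOn u (Set.Icc 0 ℓ) := by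
  refine ContinuousOn.congr ?_ h
  refine continuousOn_const.add ((intervalIntegral.continuousOn_primitive_interval ?_).mono
    Set.Icc_subset_uIcc)
  rwa [Set.uIcc_of_le hℓ]

theorem hasDerivAt_of_eq_integral {ℓ : ℝ} {u g : ℝ → ℝ} (hg : ContinuousOn g (Set.Icc 0 ℓ))
    (h : ∀ x ∈ Set.Icc 0 ℓ, u x = u 0 + ∫ t in (0 : ℝ)..x, g t) {x : ℝ}
    (hx : x ∈ Set.Ioo 0 ℓ) : HasDerivAt u (g x) x := by
  have hn : Set.Icc 0 ℓ ∈ nhds x := Icc_mem_nhds hx.1 hx.2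
  have hi : IntervalIntegrable g MeasureTheory.volume 0 x := by
    refine (hg.mono ?_).intervalIntegrable
    rw [Set.uIcc_of_le hx.1.le]
    exact Set.Icc_subset_Icc le_rfl hx.2.le
  have hm : StronglyMeasurableAtFilter g (nhds x) :=
    (hg.mono Set.Ioo_subset_Icc_self).stronglyMeasurableAtFilter isOpen_Ioo x hx
  have := (intervalIntegral.integral_hasDerivAt_right hi hm (hg.continuousAt hn)).const_add (u 0)
  exact this.congr_of_eventuallyEq (Filter.eventually_of_mem hn h)

/-- Weak solutions of `-u'' = μ u` are classical solutions. -/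
theorem IsH2.regularity {ℓ μ : ℝ} {u u' u'' : ℝ → ℝ} (hℓ : 0 ≤ ℓ) (h : IsH2 ℓ u u' u'')
    (hμ : ∀ᵐ x ∂(MeasureTheory.volume.restrict (Set.Ioo 0 ℓ)), -u'' x = μ * u x) :
    ContinuousOn u (Set.Icc 0 ℓ) ∧ ContinuousOn u' (Set.Icc 0 ℓ) ∧
      ∀ x ∈ Set.Ioo 0 ℓ, HasDerivAt u (u' x) x ∧ HasDerivAt u' (-(μ * u x)) x := by
  have hint : MeasureTheory.IntegrableOn u'' (Set.Icc 0 ℓ) := by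
    rw [integrableOn_Icc_iff_integrableOn_Ioo]
    exact h.memLp.integrable (by norm_num)
  have hc' := continuousOn_of_eq_integral hℓ hint h.deriv_eq
  have hc := continuousOn_of_eq_integral hℓ hc'.integrableOn_Icc h.eq
  refine ⟨hc, hc', fun x hx => ⟨hasDerivAt_of_eq_integral hc' h.eq hx, ?_⟩⟩
  -- The weak second derivative is replaced under the integral by the continuous function it equals
  -- almost everywhere, so that the fundamental theorem of calculus applies pointwise.
  refine hasDerivAt_of_eq_integral (g := fun x => -(μ * u x)) (by fun_prop) (fun y hy => ?_) hx
  rw [h.deriv_eq y hy]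
  congr 1
  rw [intervalIntegral.integral_of_le hy.1, intervalIntegral.integral_of_le hy.1,
    MeasureTheory.integral_Ioc_eq_integral_Ioo, MeasureTheory.integral_Ioc_eq_integral_Ioo]
  refine MeasureTheory.integral_congr_ae ?_
  filter_upwards [MeasureTheory.ae_mono (MeasureTheory.Measure.restrict_mono
    (Set.Ioo_subset_Ioo le_rfl hy.2) le_rfl) hμ] with t ht
  linarith

theorem eq_left_of_hasDerivAt_zero {ℓ : ℝ} {F : ℝ → ℝ} (hF : ContinuousOn F (Set.Icc 0 ℓ))
    (h : ∀ x ∈ Set.Ioo 0 ℓ, HasDerivAt F 0 x) {x : ℝ} (hx : x ∈ Set.Icc 0 ℓ) : F x = F 0 := by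
  rcases hx.1.eq_or_lt with rfl | h0
  · rfl
  obtain ⟨c, -, hc⟩ := exists_hasDerivAt_eq_slope F (fun _ => 0) h0
    (hF.mono (Set.Icc_subset_Icc le_rfl hx.2)) fun y hy => h y ⟨hy.1, hy.2.trans_le hx.2⟩
  have := (eq_div_iff (by linarith)).1 hc
  linarith

/-- The solutions of `-u'' = k² u` are the trigonometric ones. -/
theorem IsH2.eq_trig {ℓ k : ℝ} {u u' u'' : ℝ → ℝ} (hℓ : 0 ≤ ℓ) (h : IsH2 ℓ u u' u'')
    (hμ : ∀ᵐ x ∂(MeasureTheory.volume.restrict (Set.Ioo 0 ℓ)), -u'' x = k ^ 2 * u x)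
    {x : ℝ} (hx : x ∈ Set.Icc 0 ℓ) :
    k * u x = k * u 0 * cos (k * x) + u' 0 * sin (k * x) ∧
      u' x = -(k * u 0) * sin (k * x) + u' 0 * cos (k * x) := by
  obtain ⟨hc, hc', hd⟩ := h.regularity hℓ hμ
  have hcos (y : ℝ) : HasDerivAt (fun y => cos (k * y)) (-sin (k * y) * (k * 1)) y :=
    ((hasDerivAt_id y).const_mul k).cos
  have hsin (y : ℝ) : HasDerivAt (fun y => sin (k * y)) (cos (k * y) * (k * 1)) y :=
    ((hasDerivAt_id y).const_mul k).sin
  -- Rotating the vector `(k u, u')` by the angle `k x` gives two conserved quantities; rotating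
  -- back recovers `u` and `u'`.
  have hA := eq_left_of_hasDerivAt_zero
    (F := fun x => k * u x * cos (k * x) - u' x * sin (k * x)) (by fun_prop)
    (fun y hy => by
      refine ((((hd y hy).1.const_mul k).fun_mul (hcos y)).fun_sub
        ((hd y hy).2.fun_mul (hsin y))).congr_deriv ?_
      ring) hx
  have hB := eq_left_of_hasDerivAt_zero
    (F := fun x => k * u x * sin (k * x) + u' x * cos (k * x)) (by fun_prop)
    (fun y hy => by
      refine ((((hd y hy).1.const_mul k).fun_mul (hsin y)).fun_add
        ((hd y hy).2.fun_mul (hcos y))).congr_deriv ?_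
      ring) hx
  simp only [mul_zero, cos_zero, sin_zero, mul_one, sub_zero, zero_add] at hA hB
  have hp := sin_sq_add_cos_sq (k * x)
  constructor
  · linear_combination cos (k * x) * hA + sin (k * x) * hB - k * u x * hp
  · linear_combination cos (k * x) * hB - sin (k * x) * hA - u' x * hp

/-- The solutions of `u'' = 0` are affine. -/
theorem IsH2.eq_affine {ℓ : ℝ} {u u' u'' : ℝ → ℝ} (hℓ : 0 ≤ ℓ) (h : IsH2 ℓ u u' u'')
    (hμ : ∀ᵐ x ∂(MeasureTheory.volume.restrict (Set.Ioo 0 ℓ)), -u'' x = 0 * u x)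
    {x : ℝ} (hx : x ∈ Set.Icc 0 ℓ) : u x = u 0 + u' 0 * x := by
  obtain ⟨hc, hc', hd⟩ := h.regularity hℓ hμ
  have h1 : ∀ y ∈ Set.Icc 0 ℓ, u' y = u' 0 := fun y hy =>
    eq_left_of_hasDerivAt_zero hc' (fun z hz => by simpa using (hd z hz).2) hy
  have := eq_left_of_hasDerivAt_zero (F := fun x => u x - u' 0 * x) (by fun_prop)
    (fun y hy => by
      refine ((hd y hy).1.fun_sub ((hasDerivAt_id' y).const_mul (u' 0))).congr_deriv ?_
      rw [h1 y (Set.Ioo_subset_Icc_self hy)]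
      ring) hx
  simp only [mul_zero, sub_zero] at this
  linarith

variable {V E : Type*}

/-! ### Reduction to equations for the vertex values -/

open Classical in
/-- Sum of `a e` over the edges `e` starting at `v` and `b e` over the edges `e` ending at `v`. -/
noncomputable def incSum [Fintype E] (G : MetricGraph V E) (a b : E → ℝ) (v : V) : ℝ :=
  ∑ e, ((if G.init e = v then a e else 0) + (if G.term e = v then b e else 0))

theorem normalDerivSum_eq [Fintype E] (G : MetricGraph V E) (u' : E → ℝ → ℝ) (v : V) :
    G.normalDerivSum u' v = G.incSum (fun e => u' e 0) (fun e => -u' e (G.len e)) v := by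
  unfold normalDerivSum incSum
  refine Finset.sum_congr rfl fun e _ => ?_
  split_ifs <;> ring

theorem mul_incSum [Fintype E] (G : MetricGraph V E) (c : ℝ) (a b : E → ℝ) (v : V) :
    G.incSum (fun e => c * a e) (fun e => c * b e) v = c * G.incSum a b v := by
  unfold incSum
  rw [Finset.mul_sum]
  refine Finset.sum_congr rfl fun e _ => ?_
  split_ifs <;> ring

theorem incSum_sub [Fintype E] (G : MetricGraph V E) (a b a' b' : E → ℝ) (v : V) :
    G.incSum (fun e => a e - a' e) (fun e => b e - b' e) v =
      G.incSum a b v - G.incSum a' b' v := by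
  unfold incSum
  rw [← Finset.sum_sub_distrib]
  refine Finset.sum_congr rfl fun e _ => ?_
  split_ifs <;> ring

theorem incSum_mono [Fintype E] (G : MetricGraph V E) {a b a' b' : E → ℝ} (ha : ∀ e, a e ≤ a' e)
    (hb : ∀ e, b e ≤ b' e) (v : V) : G.incSum a b v ≤ G.incSum a' b' v := by
  unfold incSum
  refine Finset.sum_le_sum fun e _ => add_le_add ?_ ?_
  · split_ifs <;> simp [ha]
  · split_ifs <;> simp [hb]

/-- The values at the vertices of an eigenfunction determine its one-sided derivatives, and the
Kirchhoff condition becomes an equation for the vertex values. -/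
theorem IsEigenfunction.incSum_eq_zero [Fintype E] {G : MetricGraph V E} {L k : ℝ}
    (hL : ∀ e, G.len e = L) (hk : 0 < k) (hkL : k * L < π) {f : G.Fun}
    (hf : G.IsEigenfunction (k ^ 2) f) (v : V) :
    G.incSum (fun e => f.vertex (G.term e) - cos (k * L) * f.vertex (G.init e))
      (fun e => f.vertex (G.init e) - cos (k * L) * f.vertex (G.term e)) v = 0 := by
  obtain ⟨⟨e₀, -⟩, g, ⟨u', hu, hK⟩, hg⟩ := hf
  have hLpos : 0 < L := hL e₀ ▸ G.len_pos e₀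
  have hs : 0 < sin (k * L) := sin_pos_of_pos_of_lt_pi (by positivity) hkL
  have hp := sin_sq_add_cos_sq (k * L)
  have key (e : E) : sin (k * L) * u' e 0 =
        k * (f.vertex (G.term e) - cos (k * L) * f.vertex (G.init e)) ∧
      sin (k * L) * -u' e (G.len e) =
        k * (f.vertex (G.init e) - cos (k * L) * f.vertex (G.term e)) := by
    obtain ⟨h1, h2⟩ := (hu e).eq_trig (G.len_pos e).le (hg e) (Set.right_mem_Icc.2 (G.len_pos e).le)
    rw [f.edge_zero, f.edge_len] at h1
    rw [f.edge_zero] at h2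
    rw [hL] at h1 h2 ⊢
    constructor
    · linear_combination -h1
    · linear_combination -sin (k * L) * h2 + cos (k * L) * h1 +
        k * f.vertex (G.init e) * hp
  have := G.mul_incSum (sin (k * L)) (fun e => u' e 0) (fun e => -u' e (G.len e)) v
  rw [← normalDerivSum_eq, hK, mul_zero] at this
  simp only [(key _).1, (key _).2, mul_incSum] at this
  exact (mul_eq_zero.1 this).resolve_left hk.ne'

/-- An eigenfunction below `(π / L)²` does not vanish at all vertices. -/
theorem IsEigenfunction.exists_vertex_ne_zero [Fintype E] {G : MetricGraph V E} {L k : ℝ}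
    (hL : ∀ e, G.len e = L) (hk : 0 < k) (hkL : k * L < π) {f : G.Fun}
    (hf : G.IsEigenfunction (k ^ 2) f) : ∃ v, f.vertex v ≠ 0 := by
  by_contra! h0
  obtain ⟨⟨e, x, hx, hne⟩, g, ⟨u', hu, -⟩, hg⟩ := hf
  have hLpos : 0 < L := hL e ▸ G.len_pos e
  have hs : 0 < sin (k * L) := sin_pos_of_pos_of_lt_pi (by positivity) hkL
  have h1 := ((hu e).eq_trig (G.len_pos e).le (hg e) (Set.right_mem_Icc.2 (G.len_pos e).le)).1
  have h2 := ((hu e).eq_trig (G.len_pos e).le (hg e) hx).1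
  rw [f.edge_zero, f.edge_len, hL] at h1
  rw [f.edge_zero] at h2
  simp only [h0, mul_zero, zero_mul, zero_add] at h1 h2
  have h3 : u' e 0 = 0 := (mul_eq_zero.1 h1.symm).resolve_right hs.ne'
  rw [h3, zero_mul] at h2
  exact hne ((mul_eq_zero.1 h2).resolve_left hk.ne')

/-- An eigenfunction vanishing at all vertices, for a nonnegative eigenvalue, has an eigenvalue
which is at least `(π / L)²`. -/
theorem IsEigenfunction.sq_pi_div_le [Fintype E] {G : MetricGraph V E} {L μ : ℝ}
    (hL : ∀ e, G.len e = L) (hμ : 0 ≤ μ) {f : G.Fun} (hf : G.IsEigenfunction μ f)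
    (h0 : ∀ v, f.vertex v = 0) : (π / L) ^ 2 ≤ μ := by
  have hf' := hf
  obtain ⟨⟨e, x, hx, hne⟩, g, ⟨u', hu, -⟩, hg⟩ := hf'
  have hLpos : 0 < L := hL e ▸ G.len_pos e
  rcases hμ.eq_or_lt with rfl | hpos
  -- The value zero must be treated too: an infimum of positive eigenvalues is a priori only
  -- nonnegative.
  · have h1 := (hu e).eq_affine (G.len_pos e).le (hg e) (Set.right_mem_Icc.2 (G.len_pos e).le)
    have h2 := (hu e).eq_affine (G.len_pos e).le (hg e) hx
    rw [f.edge_zero, f.edge_len, hL] at h1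
    rw [f.edge_zero] at h2
    simp only [h0, zero_add] at h1 h2
    have h3 : u' e 0 = 0 := (mul_eq_zero.1 h1.symm).resolve_right hLpos.ne'
    rw [h3, zero_mul] at h2
    exact absurd h2 hne
  · by_contra! hlt
    rw [← sq_sqrt hμ] at hf hlt
    have hk := lt_of_pow_lt_pow_left₀ 2 (by positivity) hlt
    obtain ⟨v, hv⟩ := hf.exists_vertex_ne_zero hL (sqrt_pos.2 hpos) ((lt_div_iff₀ hLpos).1 hk)
    exact hv (h0 v)

/-- If the only solution of the vertex equations is zero, there are no eigenvalues in
`(0, (π / L)²)`. -/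
theorem IsEigenvalue.sq_pi_div_le [Fintype E] {G : MetricGraph V E} {L μ : ℝ}
    (hL : ∀ e, G.len e = L) (hLpos : 0 < L) (hμ : 0 < μ) (h : G.IsEigenvalue μ)
    (hG : ∀ c : ℝ, -1 < c → c < 1 → ∀ x : V → ℝ, (∀ v, G.incSum
      (fun e => x (G.term e) - c * x (G.init e))
      (fun e => x (G.init e) - c * x (G.term e)) v = 0) → ∀ v, x v = 0) :
    (π / L) ^ 2 ≤ μ := by
  by_contra! hlt
  obtain ⟨f, hf⟩ := h
  rw [← sq_sqrt hμ.le] at hf hlt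
  have hkpos := sqrt_pos.2 hμ
  have hk := (lt_div_iff₀ hLpos).1 (lt_of_pow_lt_pow_left₀ 2 (by positivity) hlt)
  obtain ⟨v, hv⟩ := hf.exists_vertex_ne_zero hL hkpos hk
  have h0 : 0 < √μ * L := by positivity
  refine hv (hG (cos (√μ * L)) ?_ ?_ f.vertex (hf.incSum_eq_zero hL hkpos hk) v)
  · rw [← cos_pi]
    exact cos_lt_cos_of_nonneg_of_le_pi h0.le le_rfl hk
  · rw [← cos_zero]
    exact cos_lt_cos_of_nonneg_of_le_pi le_rfl hk.le h0

/-! ### Eigenfunctions built from vertex values or from sines -/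

theorem hasDerivAt_cos_sin (k a b x : ℝ) :
    HasDerivAt (fun t => a * cos (k * t) + b * sin (k * t))
      (k * b * cos (k * x) + -(k * a) * sin (k * x)) x := by
  have hcos : HasDerivAt (fun y => cos (k * y)) (-sin (k * x) * (k * 1)) x :=
    ((hasDerivAt_id x).const_mul k).cos
  have hsin : HasDerivAt (fun y => sin (k * y)) (cos (k * x) * (k * 1)) x :=
    ((hasDerivAt_id x).const_mul k).sin
  refine ((hcos.const_mul a).fun_add (hsin.const_mul b)).congr_deriv ?_
  ring

/-- Gluing together trigonometric functions on the edges. -/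
theorem hasLaplacian_trig [Fintype E] {G : MetricGraph V E} {L : ℝ} (hL : ∀ e, G.len e = L)
    (k : ℝ) (a b : E → ℝ) (f : G.Fun)
    (hf : ∀ e t, f.edge e t = a e * cos (k * t) + b e * sin (k * t))
    (hK : ∀ v, G.incSum b (fun e => a e * sin (k * L) - b e * cos (k * L)) v = 0) :
    ∃ g : E → ℝ → ℝ, G.HasLaplacian f g ∧
      ∀ e, ∀ᵐ x ∂(MeasureTheory.volume.restrict (Set.Ioo 0 (G.len e))),
        -g e x = k ^ 2 * f.edge e x := by
  refine ⟨fun e t => k * -(k * a e) * cos (k * t) + -(k * (k * b e)) * sin (k * t),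
    ⟨fun e t => k * b e * cos (k * t) + -(k * a e) * sin (k * t), fun e => ?_, fun v => ?_⟩,
    fun e => Filter.Eventually.of_forall fun t => ?_⟩
  · rw [show f.edge e = _ from funext (hf e)]
    exact isH2_of_hasDerivAt (hasDerivAt_cos_sin k _ _) (hasDerivAt_cos_sin k _ _) (by fun_prop)
  · have h := G.mul_incSum k b (fun e => a e * sin (k * L) - b e * cos (k * L)) v
    rw [hK, mul_zero] at h
    rw [normalDerivSum_eq]
    refine Eq.trans ?_ h
    congr 1
    · ext e
      simp
    · ext e
      simp only [hL]
      ring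
  · simp only [hf]
    ring

/-- A solution of the vertex equations with parameter `cos θ`, `0 < θ < π`, yields an eigenvalue
below `(π / L)²`. -/
theorem isEigenvalue_of_incSum_eq_zero [Fintype E] {G : MetricGraph V E} {L θ : ℝ}
    (hL : ∀ e, G.len e = L) (hLpos : 0 < L) (h0 : 0 < θ) (hπ : θ < π) (x : V → ℝ) {e₀ : E}
    {v₀ w₀ : V} (he : G.Joins e₀ v₀ w₀) (hx : x v₀ ≠ 0)
    (h : ∀ v, G.incSum (fun e => x (G.term e) - cos θ * x (G.init e))
      (fun e => x (G.init e) - cos θ * x (G.term e)) v = 0) :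
    G.IsEigenvalue ((θ / L) ^ 2) := by
  have hs : sin θ ≠ 0 := (sin_pos_of_pos_of_lt_pi h0 hπ).ne'
  have hθ : θ / L * L = θ := div_mul_cancel₀ _ hLpos.ne'
  have hp := sin_sq_add_cos_sq θ
  -- The sine coefficient is fixed by requiring the value `x (G.term e)` at the far end.
  let b : E → ℝ := fun e => (sin θ)⁻¹ * (x (G.term e) - cos θ * x (G.init e))
  let f : G.Fun :=
    { vertex := x
      edge := fun e t => x (G.init e) * cos (θ / L * t) + b e * sin (θ / L * t)
      edge_zero := fun e => by simp
      edge_len := fun e => by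
        simp only [hL, hθ, b]
        field_simp
        ring }
  have hne : ∃ e, ∃ t ∈ Set.Icc 0 (G.len e), f.edge e t ≠ 0 := by
    rcases he with ⟨he, -⟩ | ⟨-, he⟩
    · exact ⟨e₀, 0, Set.left_mem_Icc.2 (G.len_pos e₀).le, by rwa [f.edge_zero, he]⟩
    · exact ⟨e₀, _, Set.right_mem_Icc.2 (G.len_pos e₀).le, by rwa [f.edge_len, he]⟩
  refine ⟨f, hne,
    hasLaplacian_trig hL _ (fun e => x (G.init e)) b f (fun _ _ => rfl) fun v => ?_⟩
  rw [← mul_zero (sin θ)⁻¹, ← h v, ← mul_incSum]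
  congr 1
  ext e
  simp only [hθ, b]
  field_simp
  linear_combination x (G.init e) * hp

/-- Sine functions on the edges with balanced amplitudes. -/
theorem exists_isEigenfunction_sine [Fintype E] {G : MetricGraph V E} {L : ℝ}
    (hL : ∀ e, G.len e = L) (b : E → ℝ) (e₀ : E) (hb : b e₀ ≠ 0)
    (h : ∀ v, G.incSum b b v = 0) :
    ∃ f : G.Fun, G.IsEigenfunction ((π / L) ^ 2) f ∧ ∀ v, f.vertex v = 0 := by
  have hLpos : 0 < L := hL e₀ ▸ G.len_pos e₀
  have hθ : π / L * L = π := div_mul_cancel₀ _ hLpos.ne'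
  let f : G.Fun :=
    { vertex := 0
      edge := fun e t => b e * sin (π / L * t)
      edge_zero := fun e => by simp
      edge_len := fun e => by simp [hL, hθ] }
  refine ⟨f, ⟨⟨e₀, L / 2, ⟨by positivity, by rw [hL]; linarith⟩, ?_⟩,
    hasLaplacian_trig hL _ 0 b f (fun _ _ => by simp [f]) fun v => ?_⟩, fun _ => rfl⟩
  · have : π / L * (L / 2) = π / 2 := by field_simp
    simpa [f, this] using hb
  -- Since `cos π = -1`, both inward derivatives on `e` are the same multiple of `b e`.
  · simpa [hθ] using h v

/-! ### Flowers and pumpkins -/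

theorem exists_sum_eq_zero_ne_zero [Fintype E] (hE : 2 ≤ Fintype.card E) :
    ∃ b : E → ℝ, ∑ e, b e = 0 ∧ ∃ e, b e ≠ 0 := by
  classical
  obtain ⟨e₁, e₂, hne⟩ := Fintype.exists_pair_of_one_lt_card (α := E) hE
  refine ⟨Pi.single e₁ 1 - Pi.single e₂ 1, by simp, e₁, ?_⟩
  simp [hne]

/-- If every edge contributes uniformly to the vertex sums and the vertex equations have no
nontrivial solution, the spectral gap is `(π / L)²` with an eigenfunction vanishing at all
vertices. -/
theorem exists_isEigenfunction_lambda1 [Fintype E] {G : MetricGraph V E} (hequi : G.IsEquilateral)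
    (hE : 2 ≤ Fintype.card E) (n : ℝ)
    (hinc : ∀ (b : E → ℝ) (v : V), G.incSum b b v = n * ∑ e, b e)
    (hG : ∀ c : ℝ, -1 < c → c < 1 → ∀ x : V → ℝ, (∀ v, G.incSum
      (fun e => x (G.term e) - c * x (G.init e))
      (fun e => x (G.init e) - c * x (G.term e)) v = 0) → ∀ v, x v = 0) :
    ∃ f : G.Fun, G.IsEigenfunction G.lambda1 f ∧ ∀ v : V, f.vertex v = 0 := by
  obtain ⟨b, hb, e₀, he₀⟩ := exists_sum_eq_zero_ne_zero hE
  have hL : ∀ e, G.len e = G.len e₀ := fun e => hequi e e₀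
  obtain ⟨f, hf, hv⟩ := exists_isEigenfunction_sine hL b e₀ he₀ fun v => by
    rw [hinc, hb, mul_zero]
  have hpos : 0 < (π / G.len e₀) ^ 2 := pow_pos (div_pos pi_pos (G.len_pos e₀)) 2
  have : G.lambda1 = (π / G.len e₀) ^ 2 := IsLeast.csInf_eq
    ⟨⟨hpos, f, hf⟩, fun μ hμ => IsEigenvalue.sq_pi_div_le hL (G.len_pos e₀) hμ.1 hμ.2 hG⟩
  exact ⟨f, this ▸ hf, hv⟩

/-- The only vertex equation is `2 |E| (1 - c) x = 0`, which forces `x = 0` for `c < 1`. -/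
theorem IsFlower.exists_isEigenfunction [Fintype E] {G : MetricGraph V E} (hequi : G.IsEquilateral)
    (hE : 2 ≤ Fintype.card E) (hG : G.IsFlower) :
    ∃ f : G.Fun, G.IsEigenfunction G.lambda1 f ∧ ∀ v : V, f.vertex v = 0 := by
  obtain ⟨o, ho, -⟩ := hG
  have hinc (a b : E → ℝ) (v : V) : G.incSum a b v = ∑ e, (a e + b e) := by
    simp [incSum, ho]
  refine exists_isEigenfunction_lambda1 hequi hE 2 (fun b v => ?_) fun c _ hc x hx v => ?_
  · rw [hinc, Finset.mul_sum]
    exact Finset.sum_congr rfl fun e _ => by ring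
  · have h := hx v
    rw [hinc, Finset.sum_congr rfl (g := fun _ => 2 * (1 - c) * x v)
      (fun e _ => by rw [ho (G.init e), ho (G.term e), ho v]; ring)] at h
    simp only [Finset.sum_const, Finset.card_univ, nsmul_eq_mul] at h
    have h1 : (Fintype.card E : ℝ) ≠ 0 := by positivity
    simpa [h1, sub_eq_zero, hc.ne'] using h

/-- The vertex equations reduce to `x w = c x v` and `x v = c x w`, hence `(1 - c²) x v = 0`. -/
theorem IsPumpkin.exists_isEigenfunction [Fintype E] {G : MetricGraph V E}
    (hequi : G.IsEquilateral) (hE : 2 ≤ Fintype.card E) (hG : G.IsPumpkin) :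
    ∃ f : G.Fun, G.IsEigenfunction G.lambda1 f ∧ ∀ v : V, f.vertex v = 0 := by
  obtain ⟨v, w, hne, hvw, hJ⟩ := hG
  refine exists_isEigenfunction_lambda1 hequi hE 1 (fun b u => ?_) fun c hc1 hc2 x hx => ?_
  · rw [one_mul]
    refine Finset.sum_congr rfl fun e _ => ?_
    rcases hJ e with ⟨h1, h2⟩ | ⟨h1, h2⟩ <;> rcases hvw u with rfl | rfl <;>
      simp [h1, h2, hne, hne.symm]
  · have hcard : (Fintype.card E : ℝ) ≠ 0 := by
      have : 0 < Fintype.card E := by omega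
      positivity
    have h1 := hx v
    have h2 := hx w
    rw [incSum, Finset.sum_congr rfl (g := fun _ => x w - c * x v) (fun e _ => by
      rcases hJ e with ⟨h1, h2⟩ | ⟨h1, h2⟩ <;> simp [h1, h2, hne.symm])] at h1
    rw [incSum, Finset.sum_congr rfl (g := fun _ => x v - c * x w) (fun e _ => by
      rcases hJ e with ⟨h1, h2⟩ | ⟨h1, h2⟩ <;> simp [h1, h2, hne])] at h2
    simp only [Finset.sum_const, Finset.card_univ, nsmul_eq_mul, mul_eq_zero, hcard,
      false_or] at h1 h2
    have hc : 1 - c ^ 2 ≠ 0 := by nlinarith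
    have hv : x v = 0 := (mul_eq_zero.1 (show (1 - c ^ 2) * x v = 0 by
      linear_combination h2 + c * h1)).resolve_left hc
    have hw : x w = 0 := by simpa [hv] using h1
    intro u
    rcases hvw u with rfl | rfl <;> assumption

/-! ### Spectrum of the transition matrix -/

open Classical in
/-- The adjacency matrix, a loop being counted twice. -/
noncomputable def adj [Fintype E] (G : MetricGraph V E) (v w : V) : ℝ :=
  G.incSum (fun e => if G.term e = w then 1 else 0) (fun e => if G.init e = w then 1 else 0) v

/-- The degree of a vertex, a loop being counted twice. -/
noncomputable def deg [Fintype E] (G : MetricGraph V E) (v : V) : ℝ :=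
  G.incSum (fun _ => 1) (fun _ => 1) v

theorem adj_comm [Fintype E] (G : MetricGraph V E) (v w : V) : G.adj v w = G.adj w v := by
  unfold adj incSum
  refine Finset.sum_congr rfl fun e _ => ?_
  dsimp only
  split_ifs <;> simp

theorem adj_nonneg [Fintype E] (G : MetricGraph V E) (v w : V) : 0 ≤ G.adj v w := by
  unfold adj incSum
  exact Finset.sum_nonneg fun e _ => by positivity

theorem adj_pos [Fintype E] {G : MetricGraph V E} {v w : V} {e : E} (h : G.Joins e v w) :
    0 < G.adj v w := by
  unfold adj incSum
  refine Finset.sum_pos' (fun e _ => by positivity) ⟨e, Finset.mem_univ e, ?_⟩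
  rcases h with ⟨h1, h2⟩ | ⟨h1, h2⟩ <;> simp only [h1, h2, if_true] <;> positivity

theorem sum_adj_mul [Fintype V] [Fintype E] (G : MetricGraph V E) (x : V → ℝ) (v : V) :
    ∑ w, G.adj v w * x w = G.incSum (fun e => x (G.term e)) (fun e => x (G.init e)) v := by
  classical
  simp only [adj, incSum, Finset.sum_mul]
  rw [Finset.sum_comm]
  refine Finset.sum_congr rfl fun e _ => ?_
  split_ifs <;> simp [add_mul, Finset.sum_add_distrib]

theorem adj_le_deg [Fintype E] (G : MetricGraph V E) (v w : V) : G.adj v w ≤ G.deg v :=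
  G.incSum_mono (fun e => by split_ifs <;> simp) (fun e => by split_ifs <;> simp) v

theorem IsConnected.exists_joins {G : MetricGraph V E} (h : G.IsConnected) (e₀ : E) (v : V) :
    ∃ e w, G.Joins e v w := by
  rcases Relation.ReflTransGen.cases_head (h.2 v (G.init e₀)) with rfl | ⟨w, ⟨e, he⟩, -⟩
  · exact ⟨e₀, _, Or.inl ⟨rfl, rfl⟩⟩
  · exact ⟨e, w, he⟩

theorem IsConnected.deg_pos [Fintype E] {G : MetricGraph V E} (h : G.IsConnected) (e₀ : E)
    (v : V) : 0 < G.deg v := by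
  obtain ⟨e, w, he⟩ := h.exists_joins e₀ v
  exact (adj_pos he).trans_le (G.adj_le_deg v w)

/-- The eigenvalues of the transition matrix have modulus at most one. -/
theorem abs_le_one_of_incSum_eq [Fintype V] [Fintype E] {G : MetricGraph V E}
    (hd : ∀ v, 0 < G.deg v) {α : ℝ} {x : V → ℝ} (hx : ∃ v, x v ≠ 0)
    (h : ∀ v, G.incSum (fun e => x (G.term e)) (fun e => x (G.init e)) v = α * (G.deg v * x v)) :
    |α| ≤ 1 := by
  obtain ⟨v₀, hv₀⟩ := hx
  have : Nonempty V := ⟨v₀⟩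
  -- Maximum principle: the equation is compared with the degree at a vertex where `|x|` is largest.
  obtain ⟨v, hv⟩ := Finite.exists_max fun v => |x v|
  have hpos : 0 < |x v| := (abs_pos.2 hv₀).trans_le (hv v₀)
  have h1 : G.incSum (fun e => x (G.term e)) (fun e => x (G.init e)) v ≤ |x v| * G.deg v := by
    rw [deg, ← mul_incSum]
    exact G.incSum_mono (fun e => by simpa using (le_abs_self _).trans (hv _))
      (fun e => by simpa using (le_abs_self _).trans (hv _)) v
  have h2 : -|x v| * G.deg v ≤ G.incSum (fun e => x (G.term e)) (fun e => x (G.init e)) v := by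
    rw [deg, ← mul_incSum]
    exact G.incSum_mono (fun e => by simpa using neg_le.1 ((neg_le_abs _).trans (hv _)))
      (fun e => by simpa using neg_le.1 ((neg_le_abs _).trans (hv _))) v
  have h3 : |α| * (G.deg v * |x v|) ≤ 1 * (G.deg v * |x v|) := by
    have hab : |G.deg v * x v| = G.deg v * |x v| := by rw [abs_mul, abs_of_pos (hd v)]
    rw [← hab, ← abs_mul, ← h v, hab, abs_le]
    constructor <;> linarith
  exact le_of_mul_le_mul_right h3 (mul_pos (hd v) hpos)

/-- The symmetrised transition matrix `D^(-1/2) A D^(-1/2)`. -/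
noncomputable def normAdj [Fintype E] (G : MetricGraph V E) : Matrix V V ℝ :=
  Matrix.of fun v w => G.adj v w / (√(G.deg v) * √(G.deg w))

theorem isHermitian_normAdj [Fintype E] (G : MetricGraph V E) : G.normAdj.IsHermitian := by
  ext v w
  simp [normAdj, G.adj_comm v w, mul_comm]

/-- The substitution `x = D^(-1/2) y` turns `N y = α y` into `A x = α D x`. -/
theorem incSum_eq_of_normAdj_mulVec [Fintype V] [Fintype E] {G : MetricGraph V E}
    (hd : ∀ v, 0 < G.deg v) {α : ℝ} {y : V → ℝ} (h : G.normAdj.mulVec y = α • y) (v : V) :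
    G.incSum (fun e => y (G.term e) / √(G.deg (G.term e)))
      (fun e => y (G.init e) / √(G.deg (G.init e))) v = α * (G.deg v * (y v / √(G.deg v))) := by
  rw [← G.sum_adj_mul (fun w => y w / √(G.deg w))]
  have hv := congrFun h v
  simp only [Matrix.mulVec, dotProduct, normAdj, Matrix.of_apply, Pi.smul_apply,
    smul_eq_mul] at hv
  have hs (w : V) : √(G.deg w) ≠ 0 := (sqrt_pos.2 (hd w)).ne'
  have : α * (G.deg v * (y v / √(G.deg v))) = √(G.deg v) * (α * y v) := by
    have := mul_self_sqrt (hd v).le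
    have h' := hs v
    field_simp
    linear_combination (-α * y v) * this
  rw [this, ← hv, Finset.mul_sum]
  refine Finset.sum_congr rfl fun w _ => ?_
  have := hs v
  have := hs w
  field_simp

theorem _root_.Matrix.IsHermitian.mul_self_eq_one {n : Type*} [Fintype n] [DecidableEq n]
    {M : Matrix n n ℝ} (hM : M.IsHermitian) (h : ∀ i, hM.eigenvalues i ^ 2 = 1) : M * M = 1 := by
  have hd : Matrix.diagonal ((RCLike.ofReal : ℝ → ℝ) ∘ hM.eigenvalues) *
      Matrix.diagonal ((RCLike.ofReal : ℝ → ℝ) ∘ hM.eigenvalues) = 1 := by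
    rw [Matrix.diagonal_mul_diagonal, ← Matrix.diagonal_one]
    congr 1
    ext i
    simpa [sq] using h i
  conv_lhs => rw [hM.spectral_theorem, ← map_mul, hd, map_one]

/-- Without eigenvalues below `(π / L)²`, the symmetrised transition matrix is an involution. -/
theorem normAdj_mul_self [Fintype V] [DecidableEq V] [Fintype E] {G : MetricGraph V E} {L : ℝ}
    (hconn : G.IsConnected) (hL : ∀ e, G.len e = L) (hLpos : 0 < L) (e₀ : E)
    (hG : ∀ μ, 0 < μ → G.IsEigenvalue μ → (π / L) ^ 2 ≤ μ) : G.normAdj * G.normAdj = 1 := by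
  refine G.isHermitian_normAdj.mul_self_eq_one fun i => ?_
  have hd := hconn.deg_pos e₀
  set α := G.isHermitian_normAdj.eigenvalues i
  set y : V → ℝ := ⇑(G.isHermitian_normAdj.eigenvectorBasis i)
  have hMy : G.normAdj.mulVec y = α • y := G.isHermitian_normAdj.mulVec_eigenvectorBasis i
  have h := incSum_eq_of_normAdj_mulVec hd hMy
  have hy0 : ∃ v, y v ≠ 0 := by
    by_contra! h0
    refine G.isHermitian_normAdj.eigenvectorBasis.orthonormal.ne_zero i ?_
    ext v
    exact h0 v
  set x : V → ℝ := fun w => y w / √(G.deg w) with hx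
  obtain ⟨v, hv⟩ := hy0
  have hxv : x v ≠ 0 := div_ne_zero hv (sqrt_pos.2 (hd v)).ne'
  have hα := abs_le.1 (abs_le_one_of_incSum_eq hd ⟨v, hxv⟩ h)
  by_contra hne
  have h1 : α ≠ 1 := fun h => hne (by rw [h]; norm_num)
  have h2 : α ≠ -1 := fun h => hne (by rw [h]; norm_num)
  have h3 : α < 1 := lt_of_le_of_ne hα.2 h1
  have h4 : -1 < α := lt_of_le_of_ne hα.1 h2.symm
  -- An `α` strictly between `-1` and `1` would give the eigenvalue `(arccos α / L)²`, below `(π /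
  -- L)²`.
  have hcos : cos (arccos α) = α := cos_arccos hα.1 hα.2
  have hpos : 0 < arccos α := arccos_pos.2 h3
  have hlt : arccos α < π := by
    refine lt_of_le_of_ne (arccos_le_pi α) fun h => ?_
    rw [h, cos_pi] at hcos
    linarith
  have heq (u : V) : G.incSum (fun e => x (G.term e) - α * x (G.init e))
      (fun e => x (G.init e) - α * x (G.term e)) u = 0 := by
    rw [incSum_sub, mul_incSum, h u]
    have : G.incSum (fun e => x (G.init e)) (fun e => x (G.term e)) u =
        x u * G.deg u := by
      rw [deg, ← mul_incSum]
      refine Finset.sum_congr rfl fun e _ => ?_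
      split_ifs with h1 h2 h2 <;> simp [h1, h2]
    rw [this]
    simp only [hx]
    ring
  obtain ⟨e, w, he⟩ := hconn.exists_joins e₀ v
  have hle := hG _ (by positivity) (isEigenvalue_of_incSum_eq_zero hL hLpos hpos hlt x he hxv
    (by simpa only [hcos] using heq))
  exact hle.not_gt (pow_lt_pow_left₀ (div_lt_div_of_pos_right hlt hLpos) (by positivity) two_ne_zero)

/-! ### Closed walks of length two and the conclusion -/

/-- If the symmetrised transition matrix is an involution, every walk of length two is closed. -/
theorem eq_of_joins_of_joins [Fintype V] [DecidableEq V] [Fintype E] {G : MetricGraph V E}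
    (hd : ∀ v, 0 < G.deg v) (h : G.normAdj * G.normAdj = 1) {v w u : V} {e e' : E}
    (h1 : G.Joins e v w) (h2 : G.Joins e' w u) : v = u := by
  by_contra hne
  have h0 := congrFun (congrFun h v) u
  rw [Matrix.one_apply_ne hne, Matrix.mul_apply] at h0
  have hnn (a b : V) : 0 ≤ G.normAdj a b := div_nonneg (G.adj_nonneg a b) (by positivity)
  have hpos {a b : V} {e : E} (h : G.Joins e a b) : 0 < G.normAdj a b :=
    div_pos (adj_pos h) (mul_pos (sqrt_pos.2 (hd a)) (sqrt_pos.2 (hd b)))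
  -- An off-diagonal entry of `N²` is a vanishing sum of nonnegative terms, so the term of the walk
  -- through `w` vanishes.
  have := (Finset.sum_eq_zero_iff_of_nonneg fun a _ => mul_nonneg (hnn v a) (hnn a u)).1 h0 w
    (Finset.mem_univ w)
  exact (mul_pos (hpos h1) (hpos h2)).ne' this

/-- A connected graph in which every walk of length two is closed is a pumpkin or a flower. -/
theorem IsConnected.isPumpkin_or_isFlower {G : MetricGraph V E} (hconn : G.IsConnected) (e₀ : E)
    (h : ∀ {v w u : V} {e e' : E}, G.Joins e v w → G.Joins e' w u → v = u) :
    G.IsPumpkin ∨ G.IsFlower := by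
  set v := G.init e₀
  set w := G.term e₀
  have h0 : G.Joins e₀ v w := Or.inl ⟨rfl, rfl⟩
  have h0' : G.Joins e₀ w v := Or.inr ⟨rfl, rfl⟩
  -- Every edge at `v` leads to `w` and every edge at `w` leads to `v`, so a path from `v` never
  -- leaves these two vertices.
  have hall (x : V) : x = v ∨ x = w := by
    induction hconn.2 v x with
    | refl => exact Or.inl rfl
    | tail _ hbc ih =>
      obtain ⟨e, he⟩ := hbc
      rcases ih with rfl | rfl
      · exact Or.inr (h h0' he).symm
      · exact Or.inl (h h0 he).symm
  have hinit (e : E) : G.Joins e (G.init e) (G.term e) := Or.inl ⟨rfl, rfl⟩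
  have hJ (e : E) : G.Joins e v w := by
    rcases hall (G.init e) with h1 | h1
    · exact Or.inl ⟨h1, (h h0' (h1 ▸ hinit e)).symm⟩
    · exact Or.inr ⟨h1, (h h0 (h1 ▸ hinit e)).symm⟩
  by_cases hvw : v = w
  · refine Or.inr ⟨v, fun x => ?_, fun e => ?_⟩
    · rcases hall x with rfl | rfl
      · rfl
      · exact hvw.symm
    · have := hJ e
      rwa [← hvw] at this
  · exact Or.inl ⟨v, w, hvw, hall, hJ⟩

end MetricGraph

theorem mainTheorem8 {V E : Type*} [Finite V] [Fintype E] (G : MetricGraph V E)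
    (hconn : G.IsConnected) (hequi : G.IsEquilateral) (hE : 3 ≤ Fintype.card E) :
    (∃ f : G.Fun, G.IsEigenfunction G.lambda1 f ∧ ∀ v : V, f.vertex v = 0) ↔
      (G.IsPumpkin ∨ G.IsFlower) := by
  classical
  constructor
  · rintro ⟨f, hf, h0⟩
    cases nonempty_fintype V
    obtain ⟨e₀⟩ : Nonempty E := Fintype.card_pos_iff.1 (by omega)
    have hL : ∀ e, G.len e = G.len e₀ := fun e => hequi e e₀
    -- Nonnegativity of the infimum holds even for an empty set, where `sInf` is `0`; existence of a
    -- positive eigenvalue is not needed.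
    have hle := hf.sq_pi_div_le hL (Real.sInf_nonneg fun μ hμ => hμ.1.le) h0
    have hsq := MetricGraph.normAdj_mul_self hconn hL (G.len_pos e₀) e₀ fun μ hμ hev =>
      hle.trans (csInf_le ⟨0, fun _ h => h.1.le⟩ ⟨hμ, hev⟩)
    exact hconn.isPumpkin_or_isFlower e₀
      (MetricGraph.eq_of_joins_of_joins (hconn.deg_pos e₀) hsq)
  · rintro (h | h)
    · exact h.exists_isEigenfunction hequi (by omega)
    · exact h.exists_isEigenfunction hequi (by omega)
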